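/- Let $m\ge 3$ be an integer, $\lambda=\lambda_m=2\cos(\pi/m)$, and $$L=\begin{pmatrix}1&0\\ \lambda&1\end{pmatrix},\quad S=\begin{pmatrix}0&-1\\1&0\end{pmatrix},\quad R=L^{-1}S .$$ For $j=1,\dots,m-1$ put $$A_j=SR^{-j},\quad B_j=LA_jL^{-1},\quad C_j=\begin{pmatrix}\frac1{m-1}&\frac{j-1}{m-1}\\0&1\end{pmatrix}.$$ The matrices $B_j$ and $C_j$ act by fractional linear transformations on $[0,\lambda^{-1}]$ and on $[0,1]$, respectively. For every sequence $\omega\in\{1,\dots,m-1\}^{\mathbb Z_{\ge0}}$ there are unique points $\pi_B(\omega)\in[0,\lambda^{-1}]$ and $\pi_C(\omega)\in[0,1]$ with $$\bigcap_{n\ge0}B_{\omega(0)}\cdots B_{\omega(n-1)}[0,\lambda^{-1}]=\{\pi_B(\omega)\},\qquad \bigcap_{n\ge0}C_{\omega(0)}\cdots C_{\omega(n-1)}[0,1]=\{\pi_C(\omega)\};$$ the map $\pi_B$ is onto $[0,\lambda^{-1}]$, and $\pi_C(\omega)$ depends only on $\pi_B(\omega)$, so that the Minkowski function $M_m=\pi_C\circ\pi_B^{-1}:[0,\lambda^{-1}]\to[0,1]$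 is well defined. Let $\|\cdot\|_2$ be the operator norm induced by the Euclidean norm. The joint spectral radius of a finite set $\mathscr D$ of real square matrices of the same size is $$\tilde\rho(\mathscr D)=\limsup_{n\to\infty}\max\bigl\{\|D\|_2^{1/n}: D\text{ is a product of } n\text{ elements of }\mathscr D\bigr\}.$$ Set $$\rho_m=\|A_{\lfloor m/2\rfloor}\|_2,\qquad \alpha_m=\frac{\log(m-1)}{2\log\rho_m}.$$ Then: 1. $\tilde\rho(\{A_1,\dots,A_{m-1}\})=\rho_m$; 2. $M_m$ is Hölder continuous of exponent $\alpha_m$ on $[0,\lambda^{-1}]$, that is, there is a constant $K$ with $|M_m(x)-M_m(y)|\le K|x-y|^{\alpha_m}$ for all $x,y\in[0,\lambda^{-1}]$; and $M_m$ is not Hölder continuous of exponent $\beta$ for any $\beta>\alpha_m$. -/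

import Mathlib

namespace HeckeMinkowski

noncomputable section

/-- `λ_m = 2 cos(π/m)`. -/
def lam (m : ℕ) : ℝ := 2 * Real.cos (Real.pi / m)

def L (m : ℕ) : Matrix (Fin 2) (Fin 2) ℝ := !![1, 0; lam m, 1]

def S : Matrix (Fin 2) (Fin 2) ℝ := !![0, -1; 1, 0]

def R (m : ℕ) : Matrix (Fin 2) (Fin 2) ℝ := (L m)⁻¹ * S

def A (m j : ℕ) : Matrix (Fin 2) (Fin 2) ℝ := S * (R m)⁻¹ ^ j

def B (m j : ℕ) : Matrix (Fin 2) (Fin 2) ℝ := L m * A m j * (L m)⁻¹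

def C (m j : ℕ) : Matrix (Fin 2) (Fin 2) ℝ :=
  !![1 / ((m : ℝ) - 1), ((j : ℝ) - 1) / ((m : ℝ) - 1); 0, 1]

/-- The projective action of a real `2 × 2` matrix of positive determinant on real points. -/
def mobius (D : Matrix (Fin 2) (Fin 2) ℝ) (x : ℝ) : ℝ :=
  (D 0 0 * x + D 0 1) / (D 1 0 * x + D 1 1)

/-- The level-`n` cylinder `D_{ω(0)} ∘ D_{ω(1)} ∘ ⋯ ∘ D_{ω(n-1)} [X]`. -/
def cylinder (D : ℕ → ℝ → ℝ) (X : Set ℝ) : (ℕ → ℕ) → ℕ → Set ℝ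
  | _, 0 => X
  | ω, n + 1 => D (ω 0) '' cylinder D X (fun k => ω (k + 1)) n

/-- The coding map `π_D` of an iterated function system `D` on `X`: the point `x` such that
`⋂_{n ≥ 0} D_{ω(0)} ⋯ D_{ω(n-1)} [X] = {x}`. -/
def coding (D : ℕ → ℝ → ℝ) (X : Set ℝ) (ω : ℕ → ℕ) : ℝ :=
  Classical.epsilon fun x => ⋂ n, cylinder D X ω n = {x}

/-- The sequences `{1, …, m-1}^{ℤ_{≥0}}`. -/
def digitSeq (m : ℕ) : Set (ℕ → ℕ) := {ω | ∀ n, ω n ∈ Set.Icc 1 (m - 1)}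

/-- The interval `[0, λ_m⁻¹]`. -/
def dom (m : ℕ) : Set ℝ := Set.Icc 0 (lam m)⁻¹

def actB (m j : ℕ) : ℝ → ℝ := mobius (B m j)

def actC (m j : ℕ) : ℝ → ℝ := mobius (C m j)

def piB (m : ℕ) : (ℕ → ℕ) → ℝ := coding (actB m) (dom m)

def piC (m : ℕ) : (ℕ → ℕ) → ℝ := coding (actC m) (Set.Icc 0 1)

/-- The Minkowski function `M_m = π_C ∘ π_B⁻¹`, meaningful on `[0, λ_m⁻¹]`. -/
def minkowski (m : ℕ) : ℝ → ℝ := piC m ∘ Function.invFunOn (piB m) (digitSeq m)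

/-- The operator norm of a real square matrix induced by the Euclidean norm. -/
def norm2 {d : ℕ} (D : Matrix (Fin d) (Fin d) ℝ) : ℝ :=
  ‖Matrix.toEuclideanCLM (n := Fin d) (𝕜 := ℝ) D‖

/-- The joint spectral radius of a finite set of real square matrices. -/
def jointSpectralRadius {d : ℕ} (𝒟 : Set (Matrix (Fin d) (Fin d) ℝ)) : ℝ :=
  Filter.limsup
    (fun n : ℕ => sSup {r : ℝ | ∃ l : List (Matrix (Fin d) (Fin d) ℝ),
      l.length = n ∧ (∀ D ∈ l, D ∈ 𝒟) ∧ r = norm2 l.prod ^ (1 / (n : ℝ))})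
    Filter.atTop

/-- `ρ_m = ‖A_{⌊m/2⌋}‖₂`. -/
def rho (m : ℕ) : ℝ := norm2 (A m (m / 2))

/-- `α_m = log (m-1) / (2 log ρ_m)`. -/
def alpha (m : ℕ) : ℝ := Real.log ((m : ℝ) - 1) / (2 * Real.log (rho m))

end

end HeckeMinkowski

namespace HeckeMinkowski

open Real Set Filter Topology

noncomputable section

/-! Write `s x = sin (xπ/m) / sin (π/m)`, `k = ⌊m/2⌋`, `q = m - 1`, `ρ = rho m`. The matrix `A m j`
has determinant 1, diagonal `s j` and off-diagonal entries `s (j ± 1)`. Its singular values are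
therefore `t, t⁻¹` with `t - t⁻¹ = λ s j`, largest at `j = k`. This bounds every product of length
`n` by `ρ ^ n`. Since `A m (m - k)` is the transpose of `A m k`, the alternating products are powers
of `A_kᵀ A_k` and attain the bound.

A `B`-cylinder of level `n` has length `1 / (c d)`, where `(c, d)` is the bottom row of `L A_{ω(0)}
⋯ A_{ω(n-1)}`, so its length is at least `1 / (5 ρ ^ (2n))`. The `C`-cylinders of level `n` are the
`q`-adic intervals, in the same order. If two `C`-values differ by more than `2 / q ^ n`, a whole
`B`-cylinder of level `n` separates the two points (`inv_le_sub_of_wordIndex_add_two_le`). As `(ρ ^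
2) ^ α = q`, this is the Hölder bound (`abs_piC_sub_le`), and at distance zero it says that `M_m` is
well defined.

Along the alternating sequence both `c` and `d` grow like `ρ ^ n` (`le_cylMatrix_alternating`), so
these cylinders have length of order `ρ ^ (-2n)` and no larger exponent is possible. -/

/-! ### The Chebyshev-type ratios `sin (xπ/m) / sin (π/m)` -/

/-- The ratio `sin (xπ/m) / sin (π/m)`, whose values at integers are the entries of `A m j`. -/
def sinRatio (m : ℕ) (x : ℝ) : ℝ := Real.sin (x * (π / m)) / Real.sin (π / m)

section SinRatio

variable {m : ℕ}

theorem angle_pos (hm : 3 ≤ m) : 0 < π / m := by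
  have : (3 : ℝ) ≤ m := by exact_mod_cast hm
  positivity

theorem angle_le (hm : 3 ≤ m) : π / m ≤ π / 3 := by
  have : (3 : ℝ) ≤ m := by exact_mod_cast hm
  have := pi_pos
  gcongr

theorem nat_mul_angle (hm : 3 ≤ m) : (m : ℝ) * (π / m) = π := by
  have : (3 : ℝ) ≤ m := by exact_mod_cast hm
  field_simp

theorem sin_angle_pos (hm : 3 ≤ m) : 0 < Real.sin (π / m) := by
  have h1 := angle_pos hm
  have h2 := angle_le hm
  exact sin_pos_of_pos_of_lt_pi h1 (by linarith)

theorem one_le_lam (hm : 3 ≤ m) : 1 ≤ lam m := by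
  have h1 := angle_pos hm
  have h2 := angle_le hm
  have := cos_le_cos_of_nonneg_of_le_pi h1.le (by linarith [pi_pos]) h2
  rw [cos_pi_div_three] at this
  unfold lam
  linarith

theorem lam_le_two : lam m ≤ 2 := by
  have := cos_le_one (π / m)
  unfold lam
  linarith

theorem lam_pos (hm : 3 ≤ m) : 0 < lam m := by linarith [one_le_lam hm]

@[simp]
theorem sinRatio_zero : sinRatio m 0 = 0 := by simp [sinRatio]

theorem sinRatio_one (hm : 3 ≤ m) : sinRatio m 1 = 1 := by
  simp [sinRatio, (sin_angle_pos hm).ne']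

theorem sinRatio_self_sub (hm : 3 ≤ m) (x : ℝ) : sinRatio m (m - x) = sinRatio m x := by
  rw [sinRatio, sub_mul, nat_mul_angle hm, sin_pi_sub, sinRatio]

theorem sinRatio_natCast_self (hm : 3 ≤ m) : sinRatio m m = 0 := by
  simpa using sinRatio_self_sub hm 0

theorem sinRatio_add_one_add_sub_one (x : ℝ) :
    sinRatio m (x + 1) + sinRatio m (x - 1) = lam m * sinRatio m x := by
  simp only [sinRatio, lam, add_mul, sub_mul, one_mul, sin_add, sin_sub]
  ring

theorem sinRatio_sq_sub_mul (hm : 3 ≤ m) (x : ℝ) :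
    sinRatio m x ^ 2 - sinRatio m (x - 1) * sinRatio m (x + 1) = 1 := by
  have h := (sin_angle_pos hm).ne'
  simp only [sinRatio, add_mul, sub_mul, one_mul, sin_add, sin_sub]
  have h1 := sin_sq_add_cos_sq (π / m)
  have h2 := sin_sq_add_cos_sq (x * (π / m))
  set a := Real.sin (x * (π / m))
  set b := Real.cos (x * (π / m))
  set c := Real.sin (π / m)
  set d := Real.cos (π / m)
  field_simp
  linear_combination (a ^ 2) * (- h1) + c ^ 2 * h2

theorem sinRatio_nonneg (hm : 3 ≤ m) {x : ℝ} (h0 : 0 ≤ x) (h1 : x ≤ m) : 0 ≤ sinRatio m x := by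
  have h := angle_pos hm
  refine div_nonneg (sin_nonneg_of_nonneg_of_le_pi (by positivity) ?_) (sin_angle_pos hm).le
  calc x * (π / m) ≤ m * (π / m) := by gcongr
    _ = π := nat_mul_angle hm

theorem sinRatio_mono (hm : 3 ≤ m) {x y : ℝ} (h0 : 0 ≤ x) (hxy : x ≤ y) (hy : 2 * y ≤ m) :
    sinRatio m x ≤ sinRatio m y := by
  have h := angle_pos hm
  have hs := sin_angle_pos hm
  refine div_le_div_of_nonneg_right (sin_le_sin_of_le_of_le_pi_div_two ?_ ?_ ?_) hs.le
  · have : 0 ≤ x * (π / m) := by positivity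
    linarith [pi_pos]
  · have : 2 * y * (π / m) ≤ m * (π / m) := by gcongr
    rw [nat_mul_angle hm] at this
    linarith
  · gcongr

theorem one_le_sinRatio (hm : 3 ≤ m) {x : ℝ} (h1 : 1 ≤ x) (h2 : x ≤ m - 1) :
    1 ≤ sinRatio m x := by
  rw [← sinRatio_one hm]
  rcases le_total (2 * x) m with h | h
  · exact sinRatio_mono hm zero_le_one h1 h
  · rw [← sinRatio_self_sub hm x]
    exact sinRatio_mono hm zero_le_one (by linarith) (by linarith)

/-- The sine is symmetric about `π/2` and increasing before it; reflect `j` to `m - j` when it lies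
in the right half. -/
theorem sinRatio_le_half (hm : 3 ≤ m) {j : ℕ} (hj : j ≤ m) :
    sinRatio m j ≤ sinRatio m (m / 2 : ℕ) := by
  have hk : 2 * ((m / 2 : ℕ) : ℝ) ≤ m := by exact_mod_cast Nat.mul_div_le m 2
  rcases le_total (2 * j) m with h | h
  · have : j ≤ m / 2 := by omega
    exact sinRatio_mono hm (by positivity) (by exact_mod_cast this) hk
  · rw [← sinRatio_self_sub hm j, ← Nat.cast_sub hj]
    have : m - j ≤ m / 2 := by omega
    exact sinRatio_mono hm (by positivity) (by exact_mod_cast this) hk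

end SinRatio

/-! ### Explicit form of the matrices -/

section Matrices

variable {m : ℕ}

theorem L_inv : (L m)⁻¹ = !![1, 0; -lam m, 1] := by
  refine Matrix.inv_eq_right_inv ?_
  ext i j
  fin_cases i <;> fin_cases j <;> simp [L]

theorem R_inv : (R m)⁻¹ = !![lam m, 1; -1, 0] := by
  refine Matrix.inv_eq_right_inv ?_
  rw [R, L_inv]
  ext i j
  fin_cases i <;> fin_cases j <;> simp [S]

theorem R_inv_pow (hm : 3 ≤ m) (j : ℕ) :
    (R m)⁻¹ ^ j = !![sinRatio m (j + 1), sinRatio m j; -sinRatio m j, -sinRatio m (j - 1)] := by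
  induction j with
  | zero =>
    have h := sinRatio_add_one_add_sub_one (m := m) 0
    simp only [zero_add, zero_sub, sinRatio_zero, sinRatio_one hm, mul_zero] at h
    ext i j
    fin_cases i <;> fin_cases j <;> simp [sinRatio_one hm]
    linarith
  | succ j ih =>
    have h1 := sinRatio_add_one_add_sub_one (m := m) j
    have h2 := sinRatio_add_one_add_sub_one (m := m) (j + 1)
    rw [add_sub_cancel_right] at h2
    rw [pow_succ, ih, R_inv]
    ext i j
    fin_cases i <;> fin_cases j <;> simp <;> linarith

theorem A_eq (hm : 3 ≤ m) (j : ℕ) :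
    A m j = !![sinRatio m j, sinRatio m (j - 1); sinRatio m (j + 1), sinRatio m j] := by
  rw [A, R_inv_pow hm]
  ext i j
  fin_cases i <;> fin_cases j <;> simp [S]

theorem det_A (hm : 3 ≤ m) (j : ℕ) : (A m j).det = 1 := by
  rw [A_eq hm, Matrix.det_fin_two_of]
  linarith [sinRatio_sq_sub_mul hm j]

/-- The reflection `x ↦ m - x` fixes the diagonal and swaps the off-diagonal entries. Hence `A_kᵀ
A_k` is itself a product of two generators. -/
theorem A_sub_eq_transpose (hm : 3 ≤ m) {j : ℕ} (hj : j ≤ m) :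
    A m (m - j) = (A m j).transpose := by
  rw [A_eq hm, A_eq hm, Nat.cast_sub hj, sinRatio_self_sub hm,
    show (m : ℝ) - j - 1 = m - (j + 1) by ring, show (m : ℝ) - j + 1 = m - (j - 1) by ring,
    sinRatio_self_sub hm, sinRatio_self_sub hm]
  ext i j
  fin_cases i <;> fin_cases j <;> simp

end Matrices

/-! ### The operator norm of a real unimodular `2 × 2` matrix -/

section Norm

/-- The symmetric matrix `G = t² - DᵀD`, with entries `X, Y, Z`, has positive trace and determinant
`t² (t² + t⁻² - ‖D‖_F²) ≥ 0`, so it is positive semidefinite. -/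
theorem sq_add_sq_le_of_unimodular {a b c d t : ℝ} (ht : 1 < t) (hdet : a * d - b * c = 1)
    (hF : a ^ 2 + b ^ 2 + c ^ 2 + d ^ 2 ≤ t ^ 2 + (t ^ 2)⁻¹) (x y : ℝ) :
    (a * x + b * y) ^ 2 + (c * x + d * y) ^ 2 ≤ t ^ 2 * (x ^ 2 + y ^ 2) := by
  have ht2 : 1 < t ^ 2 := one_lt_pow₀ ht two_ne_zero
  have hi : (t ^ 2)⁻¹ < 1 := inv_lt_one_of_one_lt₀ ht2
  have hmul : t ^ 2 * (t ^ 2)⁻¹ = 1 := mul_inv_cancel₀ (by positivity)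
  set T := t ^ 2
  set X := T - (a ^ 2 + c ^ 2) with hX
  set Y := -(a * b + c * d) with hY
  set Z := T - (b ^ 2 + d ^ 2) with hZ
  have hXZ : 0 < X + Z := by simp only [hX, hZ]; linarith
  have hdisc : 0 ≤ X * Z - Y ^ 2 := by
    have : X * Z - Y ^ 2 = T * (T + T⁻¹ - (a ^ 2 + b ^ 2 + c ^ 2 + d ^ 2)) := by
      simp only [hX, hY, hZ]
      linear_combination (a * d - b * c + 1) * hdet - hmul
    rw [this]
    exact mul_nonneg (by linarith) (by linarith)
  -- Cayley–Hamilton: `tr(G) G = G² + det(G)`, and both terms on the right are positive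
  -- semidefinite.
  have key : 0 ≤ (X + Z) * (X * x ^ 2 + 2 * Y * x * y + Z * y ^ 2) := by
    have : (X + Z) * (X * x ^ 2 + 2 * Y * x * y + Z * y ^ 2) =
        (X * x + Y * y) ^ 2 + (Y * x + Z * y) ^ 2 + (X * Z - Y ^ 2) * (x ^ 2 + y ^ 2) := by ring
    rw [this]
    positivity
  have := nonneg_of_mul_nonneg_right key hXZ
  simp only [hX, hY, hZ] at this
  linarith

theorem exists_sq_add_sq_eq_of_unimodular {a b c d t : ℝ} (ht : 1 < t) (hdet : a * d - b * c = 1)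
    (hF : a ^ 2 + b ^ 2 + c ^ 2 + d ^ 2 = t ^ 2 + (t ^ 2)⁻¹) :
    ∃ x y : ℝ, 0 < x ^ 2 + y ^ 2 ∧
      (a * x + b * y) ^ 2 + (c * x + d * y) ^ 2 = t ^ 2 * (x ^ 2 + y ^ 2) := by
  have hmul : t ^ 2 * (t ^ 2)⁻¹ = 1 := mul_inv_cancel₀ (by positivity)
  set T := t ^ 2
  by_cases hX : T - (a ^ 2 + c ^ 2) = 0
  · exact ⟨1, 0, by norm_num, by linarith⟩
  -- Here `t² - DᵀD` is singular, and this vector spans its kernel.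
  · refine ⟨a * b + c * d, T - (a ^ 2 + c ^ 2), by positivity, ?_⟩
    linear_combination (T - (a ^ 2 + c ^ 2)) *
      (T * hF + hmul - (a * d - b * c + 1) * hdet)

theorem norm_toLp_sq (x y : ℝ) : ‖!₂[x, y]‖ ^ 2 = x ^ 2 + y ^ 2 := by
  simp [EuclideanSpace.real_norm_sq_eq]

theorem norm_toEuclideanCLM_sq (D : Matrix (Fin 2) (Fin 2) ℝ) (v : EuclideanSpace ℝ (Fin 2)) :
    ‖Matrix.toEuclideanCLM (n := Fin 2) (𝕜 := ℝ) D v‖ ^ 2 =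
      (D 0 0 * v 0 + D 0 1 * v 1) ^ 2 + (D 1 0 * v 0 + D 1 1 * v 1) ^ 2 := by
  simp [EuclideanSpace.real_norm_sq_eq, Matrix.ofLp_toEuclideanCLM, Matrix.mulVec, dotProduct]

theorem norm2_le_of_unimodular {D : Matrix (Fin 2) (Fin 2) ℝ} {t : ℝ} (ht : 1 < t)
    (hdet : D.det = 1)
    (hF : D 0 0 ^ 2 + D 0 1 ^ 2 + D 1 0 ^ 2 + D 1 1 ^ 2 ≤ t ^ 2 + (t ^ 2)⁻¹) :
    norm2 D ≤ t := by
  refine ContinuousLinearMap.opNorm_le_bound _ (by linarith) fun v => ?_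
  refine le_of_sq_le_sq ?_ (by positivity)
  rw [Matrix.det_fin_two] at hdet
  rw [norm_toEuclideanCLM_sq, mul_pow, EuclideanSpace.real_norm_sq_eq, Fin.sum_univ_two]
  exact sq_add_sq_le_of_unimodular ht hdet hF _ _

theorem norm2_eq_of_unimodular {D : Matrix (Fin 2) (Fin 2) ℝ} {t : ℝ} (ht : 1 < t)
    (hdet : D.det = 1)
    (hF : D 0 0 ^ 2 + D 0 1 ^ 2 + D 1 0 ^ 2 + D 1 1 ^ 2 = t ^ 2 + (t ^ 2)⁻¹) :
    norm2 D = t := by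
  refine le_antisymm (norm2_le_of_unimodular ht hdet hF.le) ?_
  rw [Matrix.det_fin_two] at hdet
  obtain ⟨x, y, hpos, heq⟩ := exists_sq_add_sq_eq_of_unimodular ht hdet hF
  have h1 : ‖Matrix.toEuclideanCLM (n := Fin 2) (𝕜 := ℝ) D !₂[x, y]‖ ^ 2 =
      (t * ‖!₂[x, y]‖) ^ 2 := by
    rw [norm_toEuclideanCLM_sq, mul_pow, norm_toLp_sq]
    exact heq
  have h2 : t * ‖!₂[x, y]‖ ≤ norm2 D * ‖!₂[x, y]‖ := by
    rw [← (pow_left_inj₀ (norm_nonneg _) (by positivity) two_ne_zero).1 h1]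
    exact ContinuousLinearMap.le_opNorm _ _
  refine le_of_mul_le_mul_right h2 ?_
  rw [← norm_toLp_sq] at hpos
  exact lt_of_le_of_ne (norm_nonneg _) fun h => by simp [← h] at hpos

theorem norm2_mul_le {d : ℕ} (D E : Matrix (Fin d) (Fin d) ℝ) :
    norm2 (D * E) ≤ norm2 D * norm2 E := by
  rw [norm2, map_mul]
  exact norm_mul_le _ _

/-- The C*-identity gives `‖T²‖ = ‖T‖²` for self-adjoint `T`; iterating it reaches the exponents `2
^ n`, and a subsequence is enough for a limsup. -/
theorem norm2_transpose_mul_self_pow {d : ℕ} (D : Matrix (Fin d) (Fin d) ℝ) (n : ℕ) :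
    norm2 ((D.transpose * D) ^ 2 ^ n) = norm2 D ^ (2 * 2 ^ n) := by
  set T := Matrix.toEuclideanCLM (n := Fin d) (𝕜 := ℝ) D
  have h : Matrix.toEuclideanCLM (n := Fin d) (𝕜 := ℝ) (D.transpose * D) = star T * T := by
    rw [map_mul, ← Matrix.conjTranspose_eq_transpose_of_trivial, ← Matrix.star_eq_conjTranspose,
      map_star]
  rw [norm2, map_pow, h, (IsSelfAdjoint.star_mul_self T).norm_pow_two_pow,
    CStarRing.norm_star_mul_self, pow_mul, sq, norm2]

end Norm

/-! ### The joint spectral radius of the matrices `A m j` -/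

section Radius

variable {m : ℕ}

theorem half_mem (hm : 3 ≤ m) : m / 2 ∈ Set.Icc 1 (m - 1) := ⟨by omega, by omega⟩

theorem sub_half_mem (hm : 3 ≤ m) : m - m / 2 ∈ Set.Icc 1 (m - 1) := ⟨by omega, by omega⟩

/-- The off-diagonal entries sum to `λ s j`, and the determinant fixes the rest, so the Frobenius
norm depends on `j` only through `s j`. -/
theorem sum_sq_A (hm : 3 ≤ m) (j : ℕ) :
    A m j 0 0 ^ 2 + A m j 0 1 ^ 2 + A m j 1 0 ^ 2 + A m j 1 1 ^ 2 =
      (lam m * sinRatio m j) ^ 2 + 2 := by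
  have h1 := sinRatio_add_one_add_sub_one (m := m) j
  have h2 := sinRatio_sq_sub_mul hm j
  rw [A_eq hm, ← h1]
  simp
  linear_combination 2 * h2

theorem exists_sub_inv_eq {h : ℝ} (hh : 0 < h) : ∃ t : ℝ, 1 < t ∧ t - t⁻¹ = h := by
  have hs : 0 ≤ h ^ 2 + 4 := by positivity
  have h2 : 2 ≤ √(h ^ 2 + 4) := Real.le_sqrt_of_sq_le (by nlinarith)
  have hsq := Real.sq_sqrt hs
  refine ⟨(h + √(h ^ 2 + 4)) / 2, by linarith, ?_⟩
  set r := √(h ^ 2 + 4)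
  have : h + r ≠ 0 := by positivity
  field_simp
  linarith

theorem rho_spec (hm : 3 ≤ m) :
    1 < rho m ∧ rho m ^ 2 + (rho m ^ 2)⁻¹ = (lam m * sinRatio m (m / 2 : ℕ)) ^ 2 + 2 := by
  have hk := half_mem hm
  have hk2 : ((m / 2 : ℕ) : ℝ) ≤ m - 1 := by
    rw [le_sub_iff_add_le]
    have := hk.2
    exact_mod_cast (show m / 2 + 1 ≤ m by omega)
  have hs := one_le_sinRatio hm (x := (m / 2 : ℕ)) (by exact_mod_cast hk.1) hk2
  obtain ⟨t, ht, hteq⟩ := exists_sub_inv_eq (h := lam m * sinRatio m (m / 2 : ℕ))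
    (mul_pos (lam_pos hm) (by linarith))
  have hF : t ^ 2 + (t ^ 2)⁻¹ = (lam m * sinRatio m (m / 2 : ℕ)) ^ 2 + 2 := by
    rw [← hteq]
    field_simp
    ring
  have : rho m = t := norm2_eq_of_unimodular ht (det_A hm _) (by rw [sum_sq_A hm, hF])
  rw [this]
  exact ⟨ht, hF⟩

theorem one_lt_rho (hm : 3 ≤ m) : 1 < rho m := (rho_spec hm).1

theorem sum_sq_A_le (hm : 3 ≤ m) {j : ℕ} (hj : j ≤ m) :
    A m j 0 0 ^ 2 + A m j 0 1 ^ 2 + A m j 1 0 ^ 2 + A m j 1 1 ^ 2 ≤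
      rho m ^ 2 + (rho m ^ 2)⁻¹ := by
  rw [sum_sq_A hm, (rho_spec hm).2]
  have h1 := sinRatio_nonneg hm (x := j) (by positivity) (by exact_mod_cast hj)
  have h2 := lam_pos hm
  have h3 := sinRatio_le_half hm hj
  gcongr

theorem norm2_A_le (hm : 3 ≤ m) {j : ℕ} (hj : j ≤ m) : norm2 (A m j) ≤ rho m :=
  norm2_le_of_unimodular (one_lt_rho hm) (det_A hm j) (sum_sq_A_le hm hj)

theorem norm2_list_prod_le {d : ℕ} [NeZero d] {t : ℝ} (ht : 0 ≤ t)
    (l : List (Matrix (Fin d) (Fin d) ℝ)) (hl : ∀ D ∈ l, norm2 D ≤ t) :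
    norm2 l.prod ≤ t ^ l.length := by
  induction l with
  | nil => simp [norm2]
  | cons D l ih =>
    rw [List.prod_cons, List.length_cons, pow_succ']
    refine (norm2_mul_le _ _).trans ?_
    exact mul_le_mul (hl D (by simp)) (ih fun E hE => hl E (by simp [hE])) (norm_nonneg _) ht

theorem jointSpectralRadius_A (hm : 3 ≤ m) :
    jointSpectralRadius (A m '' Set.Icc 1 (m - 1)) = rho m := by
  have hρ := one_lt_rho hm
  have hρ0 : 0 ≤ rho m := by linarith
  unfold jointSpectralRadius
  set U : ℕ → Set ℝ := fun n => {r : ℝ | ∃ l : List (Matrix (Fin 2) (Fin 2) ℝ),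
      l.length = n ∧ (∀ D ∈ l, D ∈ A m '' Set.Icc 1 (m - 1)) ∧
        r = norm2 l.prod ^ (1 / (n : ℝ))} with hU
  have hub : ∀ n : ℕ, n ≠ 0 → ∀ r ∈ U n, r ≤ rho m := by
    rintro n hn r ⟨l, hl, hlm, rfl⟩
    have h := norm2_list_prod_le hρ0 l fun D hD => by
      obtain ⟨j, hj, rfl⟩ := hlm D hD
      exact norm2_A_le hm (by have := hj.2; omega)
    rw [hl] at h
    calc norm2 l.prod ^ (1 / (n : ℝ)) ≤ (rho m ^ n) ^ (1 / (n : ℝ)) :=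
          Real.rpow_le_rpow (norm_nonneg _) h (by positivity)
      _ = rho m := by rw [one_div, Real.pow_rpow_inv_natCast hρ0 hn]
  have hupper : ∀ᶠ n in atTop, sSup (U n) ≤ rho m := by
    filter_upwards [eventually_ne_atTop 0] with n hn
    exact Real.sSup_le (hub n hn) hρ0
  have hlow : ∀ n : ℕ, rho m ≤ sSup (U (2 * 2 ^ n)) := by
    intro n
    have hne : 2 * 2 ^ n ≠ 0 := by positivity
    refine le_csSup ⟨rho m, fun r hr => hub _ hne r hr⟩ ?_
    -- The word `A_kᵀ A_k` repeated `2 ^ n` times has norm exactly `ρ ^ (2 * 2 ^ n)`.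
    refine ⟨(List.replicate (2 ^ n) [A m (m - m / 2), A m (m / 2)]).flatten, ?_, ?_, ?_⟩
    · simp [mul_comm]
    · intro D hD
      simp only [List.mem_flatten, List.mem_replicate] at hD
      obtain ⟨l, ⟨-, rfl⟩, hD⟩ := hD
      rcases List.mem_pair.1 hD with rfl | rfl
      · exact ⟨_, sub_half_mem hm, rfl⟩
      · exact ⟨_, half_mem hm, rfl⟩
    · rw [List.prod_flatten, List.map_replicate, List.prod_replicate, List.prod_pair,
        A_sub_eq_transpose hm (Nat.div_le_self _ _), norm2_transpose_mul_self_pow, one_div,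
        ← rho, Real.pow_rpow_inv_natCast hρ0 hne]
  have hfreq : ∃ᶠ n in atTop, rho m ≤ sSup (U n) := by
    refine frequently_atTop.2 fun a => ⟨2 * 2 ^ a, ?_, hlow a⟩
    have := a.lt_two_pow_self
    omega
  have hnonneg : ∀ n, 0 ≤ sSup (U n) := by
    refine fun n => Real.sSup_nonneg ?_
    rintro r ⟨l, -, -, rfl⟩
    exact Real.rpow_nonneg (norm_nonneg _) _
  refine le_antisymm ?_ ?_
  · exact limsup_le_of_le (isCoboundedUnder_le_of_le atTop hnonneg) hupper
  · exact le_limsup_of_frequently_le hfreq ⟨rho m, hupper⟩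

end Radius

/-! ### Cylinders of iterated function systems -/

section Cylinder

variable {D : ℕ → ℝ → ℝ} {X : Set ℝ} {J : Set ℕ}

theorem cylinder_subset (hD : ∀ j ∈ J, MapsTo (D j) X X) {ω : ℕ → ℕ} (hω : ∀ n, ω n ∈ J)
    (n : ℕ) : cylinder D X ω n ⊆ X := by
  induction n generalizing ω with
  | zero => exact subset_rfl
  | succ n ih =>
    rintro _ ⟨x, hx, rfl⟩
    exact hD _ (hω 0) (ih (fun k => hω (k + 1)) hx)

theorem cylinder_succ_subset (hD : ∀ j ∈ J, MapsTo (D j) X X) {ω : ℕ → ℕ} (hω : ∀ n, ω n ∈ J)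
    (n : ℕ) : cylinder D X ω (n + 1) ⊆ cylinder D X ω n := by
  induction n generalizing ω with
  | zero => exact cylinder_subset hD hω 1
  | succ n ih => exact image_mono (ih fun k => hω (k + 1))

theorem exists_iInter_eq_singleton {K : ℕ → Set ℝ} {a b : ℕ → ℝ} (hK : ∀ n, K n = Icc (a n) (b n))
    (hanti : ∀ n, K (n + 1) ⊆ K n) (hab : ∀ n, a n ≤ b n)
    (hlim : Tendsto (fun n => b n - a n) atTop (𝓝 0)) : ∃ x, ⋂ n, K n = {x} := by
  obtain ⟨x, hx⟩ := IsCompact.nonempty_iInter_of_sequence_nonempty_isCompact_isClosed K hanti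
    (fun n => by rw [hK]; exact nonempty_Icc.2 (hab n)) (by rw [hK]; exact isCompact_Icc)
    (fun n => by rw [hK]; exact isClosed_Icc)
  refine ⟨x, Subset.antisymm (fun y hy => ?_) (singleton_subset_iff.2 hx)⟩
  rw [mem_iInter] at hx hy
  have h : |y - x| ≤ 0 := ge_of_tendsto' hlim fun n => by
    have h1 := hx n
    have h2 := hy n
    rw [hK, mem_Icc] at h1 h2
    rw [abs_le]
    constructor <;> linarith
  exact sub_eq_zero.1 (abs_nonpos_iff.1 h)

theorem iInter_cylinder_eq_coding {ω : ℕ → ℕ} (h : ∃ x, ⋂ n, cylinder D X ω n = {x}) :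
    ⋂ n, cylinder D X ω n = {coding D X ω} :=
  Classical.epsilon_spec h

end Cylinder

/-! ### The maps `B_j` on `[0, λ⁻¹]` -/

section ActB

variable {m j : ℕ}

theorem natCast_bounds_of_digit (hm : 3 ≤ m) (hj : j ∈ Icc 1 (m - 1)) :
    (1 : ℝ) ≤ j ∧ (j : ℝ) ≤ m - 1 := by
  obtain ⟨h1, h2⟩ := hj
  refine ⟨by exact_mod_cast h1, ?_⟩
  rw [le_sub_iff_add_le]
  exact_mod_cast (show j + 1 ≤ m by omega)

theorem one_le_sinRatio_digit (hm : 3 ≤ m) (hj : j ∈ Icc 1 (m - 1)) : 1 ≤ sinRatio m j := by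
  obtain ⟨h1, h2⟩ := natCast_bounds_of_digit hm hj
  exact one_le_sinRatio hm h1 h2

theorem sinRatio_digit_sub_one_nonneg (hm : 3 ≤ m) (hj : j ∈ Icc 1 (m - 1)) :
    0 ≤ sinRatio m (j - 1) := by
  obtain ⟨h1, h2⟩ := natCast_bounds_of_digit hm hj
  exact sinRatio_nonneg hm (by linarith) (by linarith)

theorem sinRatio_digit_add_one_nonneg (hm : 3 ≤ m) (hj : j ∈ Icc 1 (m - 1)) :
    0 ≤ sinRatio m (j + 1) := by
  obtain ⟨h1, h2⟩ := natCast_bounds_of_digit hm hj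
  exact sinRatio_nonneg hm (by linarith) (by linarith)

/-- Both `x` and `1 - λ x` are nonnegative on `dom m`. In these coordinates the denominator is
visibly positive, and one of them vanishes at each endpoint. -/
theorem actB_eq (hm : 3 ≤ m) (j : ℕ) (x : ℝ) :
    actB m j x = ((1 - lam m * x) * sinRatio m (j - 1) + x * sinRatio m j) /
      ((1 - lam m * x) * (lam m * sinRatio m (j - 1) + sinRatio m j) +
        x * (lam m * sinRatio m j + sinRatio m (j + 1))) := by
  have h := sinRatio_add_one_add_sub_one (m := m) j
  rw [actB, mobius, B, A_eq hm, L_inv]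
  simp only [L, Matrix.mul_apply, Fin.sum_univ_two, Matrix.of_apply, Matrix.cons_val',
    Matrix.cons_val_zero, Matrix.cons_val_one, Matrix.cons_val_fin_one]
  congr 1 <;> ring

theorem actB_den_pos (hm : 3 ≤ m) (hj : j ∈ Icc 1 (m - 1)) {x : ℝ} (hx : x ∈ dom m) :
    0 < (1 - lam m * x) * (lam m * sinRatio m (j - 1) + sinRatio m j) +
        x * (lam m * sinRatio m j + sinRatio m (j + 1)) := by
  have hl := one_le_lam hm
  have h1 := one_le_sinRatio_digit hm hj
  have h2 := sinRatio_digit_sub_one_nonneg hm hj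
  have h3 := sinRatio_digit_add_one_nonneg hm hj
  have hx1 : lam m * x ≤ 1 := by
    have := mul_le_mul_of_nonneg_left hx.2 (show 0 ≤ lam m by linarith)
    rwa [mul_inv_cancel₀ (by positivity)] at this
  have hp : 0 ≤ lam m * sinRatio m (j - 1) := by positivity
  have hx0 : 0 ≤ x := hx.1
  calc (0 : ℝ) < (1 - lam m * x) * 1 + x * lam m := by linarith
    _ ≤ _ := by
      refine add_le_add (mul_le_mul_of_nonneg_left (by linarith) (by linarith))
        (mul_le_mul_of_nonneg_left ?_ hx0)
      nlinarith

theorem actB_continuousOn (hm : 3 ≤ m) (hj : j ∈ Icc 1 (m - 1)) :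
    ContinuousOn (actB m j) (dom m) := by
  rw [show actB m j = _ from funext (actB_eq hm j)]
  exact ContinuousOn.div (by fun_prop) (by fun_prop) fun x hx => (actB_den_pos hm hj hx).ne'

theorem actB_monotoneOn (hm : 3 ≤ m) (hj : j ∈ Icc 1 (m - 1)) :
    MonotoneOn (actB m j) (dom m) := by
  intro x hx y hy hxy
  have hdet := sinRatio_sq_sub_mul hm j
  rw [actB_eq hm, actB_eq hm, div_le_div_iff₀ (actB_den_pos hm hj hx) (actB_den_pos hm hj hy)]
  rw [← sub_nonneg] at hxy ⊢
  convert hxy using 1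
  -- Determinant one: the cross-multiplied difference is exactly `y - x`.
  linear_combination (y - x) * hdet

theorem zero_mem_dom (hm : 3 ≤ m) : (0 : ℝ) ∈ dom m :=
  ⟨le_rfl, (inv_pos.2 (lam_pos hm)).le⟩

theorem lam_inv_mem_dom (hm : 3 ≤ m) : (lam m)⁻¹ ∈ dom m :=
  ⟨(inv_pos.2 (lam_pos hm)).le, le_rfl⟩

/-- The endpoints of the intervals `B_j [0, λ⁻¹]`. -/
def cut (m j : ℕ) : ℝ := sinRatio m (j - 1) / (lam m * sinRatio m (j - 1) + sinRatio m j)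

theorem actB_zero (hm : 3 ≤ m) (j : ℕ) : actB m j 0 = cut m j := by
  rw [actB_eq hm, cut]
  congr 1 <;> ring

/-- The right end of the `j`-th image is the left end of the next, so the images tile `dom m` in
order. -/
theorem actB_lam_inv (hm : 3 ≤ m) (j : ℕ) : actB m j (lam m)⁻¹ = cut m (j + 1) := by
  have h := lam_pos hm
  have h' : lam m * (lam m)⁻¹ = 1 := mul_inv_cancel₀ h.ne'
  rw [actB_eq hm, cut, h', sub_self, zero_mul, zero_mul, zero_add, zero_add,
    mul_div_mul_left _ _ (inv_pos.2 h).ne', Nat.cast_add, Nat.cast_one, add_sub_cancel_right]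

theorem cut_one : cut m 1 = 0 := by simp [cut]

theorem cut_self (hm : 3 ≤ m) : cut m m = (lam m)⁻¹ := by
  have h := lam_pos hm
  rw [cut, sinRatio_natCast_self hm, sinRatio_self_sub hm, sinRatio_one hm]
  simp

theorem cut_le_succ (hm : 3 ≤ m) (hj : j ∈ Icc 1 (m - 1)) : cut m j ≤ cut m (j + 1) := by
  rw [← actB_zero hm, ← actB_lam_inv hm]
  exact actB_monotoneOn hm hj (zero_mem_dom hm) (lam_inv_mem_dom hm) (zero_mem_dom hm).2

theorem cut_mono (hm : 3 ≤ m) {i j : ℕ} (hi : 1 ≤ i) (hij : i ≤ j) (hj : j ≤ m) :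
    cut m i ≤ cut m j := by
  induction j, hij using Nat.le_induction with
  | base => exact le_rfl
  | succ k hk ih => exact (ih (by omega)).trans (cut_le_succ hm ⟨by omega, by omega⟩)

theorem image_actB_Icc (hm : 3 ≤ m) (hj : j ∈ Icc 1 (m - 1)) {a b : ℝ} (ha : a ∈ dom m)
    (hb : b ∈ dom m) (hab : a ≤ b) : actB m j '' Icc a b = Icc (actB m j a) (actB m j b) := by
  have hsub : Icc a b ⊆ dom m := Icc_subset_Icc ha.1 hb.2
  exact ((actB_continuousOn hm hj).mono hsub).image_Icc_of_monotoneOn hab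
    ((actB_monotoneOn hm hj).mono hsub)

theorem image_actB_dom (hm : 3 ≤ m) (hj : j ∈ Icc 1 (m - 1)) :
    actB m j '' dom m = Icc (cut m j) (cut m (j + 1)) := by
  rw [dom, image_actB_Icc hm hj (zero_mem_dom hm) (lam_inv_mem_dom hm) (zero_mem_dom hm).2,
    actB_zero hm, actB_lam_inv hm]

theorem actB_mapsTo (hm : 3 ≤ m) : ∀ j ∈ Icc 1 (m - 1), MapsTo (actB m j) (dom m) (dom m) := by
  intro j hj
  rw [mapsTo_iff_image_subset, image_actB_dom hm hj, dom, ← cut_one (m := m), ← cut_self hm]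
  obtain ⟨h1, h2⟩ := hj
  exact Icc_subset_Icc (cut_mono hm le_rfl h1 (by omega)) (cut_mono hm (by omega) (by omega) le_rfl)

theorem exists_actB_eq (hm : 3 ≤ m) {x : ℝ} (hx : x ∈ dom m) :
    ∃ j ∈ Icc 1 (m - 1), ∃ y ∈ dom m, actB m j y = x := by
  have key : ∀ k, 1 ≤ k → k ≤ m - 1 → x ≤ cut m (k + 1) →
      ∃ j ∈ Icc 1 (m - 1), x ∈ Icc (cut m j) (cut m (j + 1)) := by
    intro k hk
    induction k, hk using Nat.le_induction with
    | base => exact fun h1 hxk => ⟨1, ⟨le_rfl, h1⟩, by rw [cut_one]; exact hx.1, hxk⟩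
    | succ k hk ih =>
      intro h1 hxk
      rcases le_total x (cut m (k + 1)) with h | h
      · exact ih (by omega) h
      · exact ⟨k + 1, ⟨by omega, h1⟩, h, hxk⟩
  obtain ⟨j, hj, hxj⟩ := key (m - 1) (by omega) le_rfl (by
    rw [Nat.sub_add_cancel (by omega), cut_self hm]
    exact hx.2)
  rw [← image_actB_dom hm hj] at hxj
  exact ⟨j, hj, hxj⟩

end ActB

/-! ### The cylinders of the maps `B_j` -/

section CylinderB

variable {m : ℕ} {ω : ℕ → ℕ}

theorem mobius_div (D : Matrix (Fin 2) (Fin 2) ℝ) (u : ℝ) {v : ℝ} (hv : v ≠ 0) :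
    mobius D (u / v) = (D 0 0 * u + D 0 1 * v) / (D 1 0 * u + D 1 1 * v) := by
  rw [mobius, ← mul_div_mul_right _ _ hv]
  congr 1 <;> field_simp

/-- The matrix `L A_{ω(0)} ⋯ A_{ω(n-1)}`. -/
def cylMatrix (m : ℕ) (ω : ℕ → ℕ) (n : ℕ) : Matrix (Fin 2) (Fin 2) ℝ :=
  L m * ((List.range n).map fun i => A m (ω i)).prod

theorem cylMatrix_zero : cylMatrix m ω 0 = L m := by simp [cylMatrix]

theorem cylMatrix_succ (n : ℕ) : cylMatrix m ω (n + 1) = cylMatrix m ω n * A m (ω n) := by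
  simp [cylMatrix, List.range_succ, mul_assoc]

theorem L_inv_mul_L : (L m)⁻¹ * L m = 1 :=
  Matrix.nonsing_inv_mul _ (by simp [L, Matrix.det_fin_two_of])

/-- Since `B_j L = L A_j`, the conjugations telescope to `B ⋯ B L`. The columns of `L` represent
`λ⁻¹` and `0`, so the columns of `cylMatrix` represent the ends of the cylinder. -/
theorem cylMatrix_succ_left (n : ℕ) :
    cylMatrix m ω (n + 1) = B m (ω 0) * cylMatrix m (fun k => ω (k + 1)) n := by
  rw [cylMatrix, cylMatrix, B, List.range_succ_eq_map, List.map_cons, List.prod_cons,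
    List.map_map, mul_assoc _ (L m)⁻¹, ← mul_assoc (L m)⁻¹, L_inv_mul_L, one_mul, mul_assoc]
  rfl

theorem det_cylMatrix (hm : 3 ≤ m) (n : ℕ) : (cylMatrix m ω n).det = 1 := by
  induction n with
  | zero => simp [cylMatrix_zero, L, Matrix.det_fin_two_of]
  | succ n ih => rw [cylMatrix_succ, Matrix.det_mul, ih, det_A hm, one_mul]

theorem cylMatrix_row_zero : cylMatrix m ω 0 1 0 = lam m ∧ cylMatrix m ω 0 1 1 = 1 := by
  simp [cylMatrix_zero, L]

theorem cylMatrix_row_succ (hm : 3 ≤ m) (n : ℕ) :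
    cylMatrix m ω (n + 1) 1 0 = cylMatrix m ω n 1 0 * sinRatio m (ω n) +
        cylMatrix m ω n 1 1 * sinRatio m (ω n + 1) ∧
      cylMatrix m ω (n + 1) 1 1 = cylMatrix m ω n 1 0 * sinRatio m (ω n - 1) +
        cylMatrix m ω n 1 1 * sinRatio m (ω n) := by
  rw [cylMatrix_succ, A_eq hm]
  simp [Matrix.mul_apply]

theorem cylMatrix_row_lower (hm : 3 ≤ m) (hω : ω ∈ digitSeq m) (n : ℕ) :
    1 ≤ cylMatrix m ω n 1 0 ∧ 1 ≤ cylMatrix m ω n 1 1 ∧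
      n + 2 ≤ cylMatrix m ω n 1 0 + cylMatrix m ω n 1 1 := by
  induction n with
  | zero =>
    rw [cylMatrix_row_zero.1, cylMatrix_row_zero.2]
    have := one_le_lam hm
    refine ⟨this, le_rfl, ?_⟩
    push_cast
    linarith
  | succ n ih =>
    obtain ⟨hc, hd, hcd⟩ := ih
    rw [(cylMatrix_row_succ hm n).1, (cylMatrix_row_succ hm n).2]
    set c := cylMatrix m ω n 1 0
    set d := cylMatrix m ω n 1 1
    have h1 := one_le_sinRatio_digit hm (hω n)
    have h2 := sinRatio_digit_sub_one_nonneg hm (hω n)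
    have h3 := sinRatio_digit_add_one_nonneg hm (hω n)
    have hc1 : c ≤ c * sinRatio m (ω n) := le_mul_of_one_le_right (by linarith) h1
    have hd1 : d ≤ d * sinRatio m (ω n) := le_mul_of_one_le_right (by linarith) h1
    have hp : 0 ≤ c * sinRatio m (ω n - 1) := by positivity
    have hq : 0 ≤ d * sinRatio m (ω n + 1) := by positivity
    refine ⟨by linarith, by linarith, ?_⟩
    -- At least one neighbour of the digit again lies in `1, …, m - 1`: the upper one for digit 1,
    -- the lower one otherwise.
    have hone : 1 ≤ c * sinRatio m (ω n - 1) + d * sinRatio m (ω n + 1) := by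
      obtain ⟨hj1, hj2⟩ := natCast_bounds_of_digit hm (hω n)
      have hm3 : (3 : ℝ) ≤ m := by exact_mod_cast hm
      rcases (hω n).1.eq_or_lt with h | h
      · have : 1 ≤ sinRatio m (ω n + 1) := by
          rw [← h]
          exact one_le_sinRatio hm (by norm_num) (by push_cast; linarith)
        nlinarith
      · have h' : (2 : ℝ) ≤ ω n := by exact_mod_cast h
        have : 1 ≤ sinRatio m (ω n - 1) := one_le_sinRatio hm (by linarith) (by linarith)
        nlinarith
    push_cast
    linarith

/-- Each step applies the transpose of some `A m j` to the row, stretching it by at most `ρ`. The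
initial row `(λ, 1)` has squared length at most 5. -/
theorem cylMatrix_row_sq_le (hm : 3 ≤ m) (hω : ω ∈ digitSeq m) (n : ℕ) :
    cylMatrix m ω n 1 0 ^ 2 + cylMatrix m ω n 1 1 ^ 2 ≤ 5 * (rho m ^ 2) ^ n := by
  induction n with
  | zero =>
    rw [cylMatrix_row_zero.1, cylMatrix_row_zero.2]
    have h1 := one_le_lam hm
    have h2 := lam_le_two (m := m)
    nlinarith
  | succ n ih =>
    rw [(cylMatrix_row_succ hm n).1, (cylMatrix_row_succ hm n).2]
    set c := cylMatrix m ω n 1 0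
    set d := cylMatrix m ω n 1 1
    have hF := sum_sq_A_le hm (j := ω n) (by have := (hω n).2; omega)
    have hdet := sinRatio_sq_sub_mul hm (ω n)
    rw [A_eq hm] at hF
    simp only [Matrix.of_apply, Matrix.cons_val', Matrix.cons_val_zero, Matrix.cons_val_one,
      Matrix.cons_val_fin_one] at hF
    have h := sq_add_sq_le_of_unimodular (one_lt_rho hm) (a := sinRatio m (ω n))
      (b := sinRatio m (ω n + 1)) (c := sinRatio m (ω n - 1)) (d := sinRatio m (ω n))
      (by linarith) (by linarith) c d
    calc _ = (sinRatio m (ω n) * c + sinRatio m (ω n + 1) * d) ^ 2 +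
          (sinRatio m (ω n - 1) * c + sinRatio m (ω n) * d) ^ 2 := by ring
      _ ≤ rho m ^ 2 * (c ^ 2 + d ^ 2) := h
      _ ≤ rho m ^ 2 * (5 * (rho m ^ 2) ^ n) := by gcongr
      _ = _ := by ring

theorem cylMatrix_right_sub_left (hm : 3 ≤ m) (hω : ω ∈ digitSeq m) (n : ℕ) :
    cylMatrix m ω n 0 0 / cylMatrix m ω n 1 0 - cylMatrix m ω n 0 1 / cylMatrix m ω n 1 1 =
      (cylMatrix m ω n 1 0 * cylMatrix m ω n 1 1)⁻¹ := by
  obtain ⟨hc, hd, -⟩ := cylMatrix_row_lower hm hω n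
  have hdet := det_cylMatrix (ω := ω) hm n
  rw [Matrix.det_fin_two] at hdet
  have hc0 : cylMatrix m ω n 1 0 ≠ 0 := by positivity
  have hd0 : cylMatrix m ω n 1 1 ≠ 0 := by positivity
  field_simp
  linarith

theorem shift_mem_digitSeq (hω : ω ∈ digitSeq m) : (fun k => ω (k + 1)) ∈ digitSeq m :=
  fun n => hω (n + 1)

theorem cylinder_actB_eq (hm : 3 ≤ m) (hω : ω ∈ digitSeq m) (n : ℕ) :
    cylinder (actB m) (dom m) ω n = Icc (cylMatrix m ω n 0 1 / cylMatrix m ω n 1 1)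
      (cylMatrix m ω n 0 0 / cylMatrix m ω n 1 0) := by
  induction n generalizing ω with
  | zero => simp [cylinder, cylMatrix_zero, L, dom]
  | succ n ih =>
    have hω' := shift_mem_digitSeq hω
    have hsub := cylinder_subset (actB_mapsTo hm) hω' n
    obtain ⟨hc, hd, -⟩ := cylMatrix_row_lower hm hω' n
    have hle : cylMatrix m (fun k => ω (k + 1)) n 0 1 / cylMatrix m (fun k => ω (k + 1)) n 1 1 ≤
        cylMatrix m (fun k => ω (k + 1)) n 0 0 / cylMatrix m (fun k => ω (k + 1)) n 1 0 := by
      rw [← sub_nonneg, cylMatrix_right_sub_left hm hω']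
      positivity
    rw [ih hω'] at hsub
    rw [cylinder, ih hω', image_actB_Icc hm (hω 0) (hsub (left_mem_Icc.2 hle))
      (hsub (right_mem_Icc.2 hle)) hle, actB, mobius_div _ _ (by positivity),
      mobius_div _ _ (by positivity), cylMatrix_succ_left]
    simp only [Matrix.mul_apply, Fin.sum_univ_two]

theorem iInter_cylinder_actB (hm : 3 ≤ m) (hω : ω ∈ digitSeq m) :
    ⋂ n, cylinder (actB m) (dom m) ω n = {piB m ω} := by
  refine iInter_cylinder_eq_coding (exists_iInter_eq_singleton (cylinder_actB_eq hm hω)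
    (cylinder_succ_subset (actB_mapsTo hm) hω) (fun n => ?_) ?_)
  · obtain ⟨hc, hd, -⟩ := cylMatrix_row_lower hm hω n
    rw [← sub_nonneg, cylMatrix_right_sub_left hm hω]
    positivity
  · refine squeeze_zero (fun n => ?_) (fun n => ?_) tendsto_one_div_add_atTop_nhds_zero_nat
    · obtain ⟨hc, hd, -⟩ := cylMatrix_row_lower hm hω n
      rw [cylMatrix_right_sub_left hm hω]
      positivity
    · obtain ⟨hc, hd, hcd⟩ := cylMatrix_row_lower hm hω n
      rw [cylMatrix_right_sub_left hm hω, one_div]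
      refine inv_anti₀ (by positivity) ?_
      -- From `(c - 1)(d - 1) ≥ 0`: `c d ≥ c + d - 1 ≥ n + 1`.
      nlinarith [mul_nonneg (sub_nonneg.2 hc) (sub_nonneg.2 hd)]

theorem piB_mem_cylinder (hm : 3 ≤ m) (hω : ω ∈ digitSeq m) (n : ℕ) :
    piB m ω ∈ cylinder (actB m) (dom m) ω n := by
  have h : piB m ω ∈ ⋂ n, cylinder (actB m) (dom m) ω n := by
    rw [iInter_cylinder_actB hm hω]
    rfl
  exact mem_iInter.1 h n

theorem image_piB (hm : 3 ≤ m) : piB m '' digitSeq m = dom m := by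
  refine Subset.antisymm ?_ fun x hx => ?_
  · rintro _ ⟨ω, hω, rfl⟩
    exact piB_mem_cylinder hm hω 0
  -- `d` picks a digit and `T` a preimage under that branch; the digits along the `T`-orbit code
  -- `x`.
  · choose! d hd T hT hdT using fun x (hx : x ∈ dom m) => exists_actB_eq hm hx
    have hTn : ∀ n, T^[n] x ∈ dom m := fun n => by
      induction n with
      | zero => exact hx
      | succ n ih => rw [Function.iterate_succ_apply']; exact hT _ ih
    have hω : (fun n => d (T^[n] x)) ∈ digitSeq m := fun n => hd _ (hTn n)
    refine ⟨_, hω, ?_⟩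
    have hmem : ∀ n, ∀ y ∈ dom m, y ∈ cylinder (actB m) (dom m) (fun k => d (T^[k] y)) n := by
      intro n
      induction n with
      | zero => exact fun y hy => hy
      | succ n ih => exact fun y hy => ⟨T y, ih _ (hT y hy), hdT y hy⟩
    have h := mem_iInter.2 fun n => hmem n x hx
    rw [iInter_cylinder_actB hm hω] at h
    exact h.symm

end CylinderB

/-! ### The position of a cylinder among those of its level -/

/-- The number of words of length `n` in the digits `1, …, q` that precede `ω(0) ⋯ ω(n-1)`. -/
def wordIndex (q : ℕ) : (ℕ → ℕ) → ℕ → ℕ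
  | _, 0 => 0
  | ω, n + 1 => (ω 0 - 1) * q ^ n + wordIndex q (fun k => ω (k + 1)) n

section WordIndex

variable {m : ℕ} {ω ω' : ℕ → ℕ}

theorem wordIndex_succ (q : ℕ) (ω : ℕ → ℕ) (n : ℕ) :
    wordIndex q ω (n + 1) = wordIndex q ω n * q + (ω n - 1) := by
  induction n generalizing ω with
  | zero => simp [wordIndex]
  | succ n ih => rw [wordIndex, ih, wordIndex]; ring

theorem wordIndex_congr (q : ℕ) {n : ℕ} (h : ∀ i < n, ω i = ω' i) :
    wordIndex q ω n = wordIndex q ω' n := by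
  induction n with
  | zero => rfl
  | succ n ih =>
    rw [wordIndex_succ, wordIndex_succ, ih fun i hi => h i (by omega), h n (by omega)]

theorem wordIndex_lt (hm : 3 ≤ m) (hω : ω ∈ digitSeq m) (n : ℕ) :
    wordIndex (m - 1) ω n < (m - 1) ^ n := by
  induction n with
  | zero => simp [wordIndex]
  | succ n ih =>
    rw [wordIndex_succ, pow_succ]
    have h1 := (hω n).2
    calc _ < wordIndex (m - 1) ω n * (m - 1) + (m - 1) := by omega
      _ = (wordIndex (m - 1) ω n + 1) * (m - 1) := by ring
      _ ≤ _ := Nat.mul_le_mul_right _ ih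

theorem exists_wordIndex_eq (hm : 3 ≤ m) {n N : ℕ} (hN : N < (m - 1) ^ n) :
    ∃ ω ∈ digitSeq m, wordIndex (m - 1) ω n = N := by
  induction n generalizing N with
  | zero => exact ⟨fun _ => 1, fun _ => ⟨le_rfl, show 1 ≤ m - 1 by omega⟩, by simp [wordIndex] at hN ⊢; omega⟩
  | succ n ih =>
    have hq : 0 < m - 1 := by omega
    rw [pow_succ] at hN
    obtain ⟨ω, hω, hωN⟩ := ih (Nat.div_lt_of_lt_mul (by rwa [mul_comm] at hN))
    have hmod := Nat.mod_lt N hq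
    refine ⟨fun i => if i < n then ω i else N % (m - 1) + 1, fun i => ?_, ?_⟩
    · dsimp only
      split_ifs
      · exact hω i
      · exact ⟨by omega, by omega⟩
    · rw [wordIndex_succ, wordIndex_congr (ω' := ω) _ fun i hi => if_pos hi, hωN]
      simpa using Nat.div_add_mod' N (m - 1)

/-- The branches are increasing and their images tile in digit order, so cylinders are ordered
lexicographically. -/
theorem le_of_wordIndex_lt (hm : 3 ≤ m) (hω : ω ∈ digitSeq m) (hω' : ω' ∈ digitSeq m) {n : ℕ}
    (h : wordIndex (m - 1) ω n < wordIndex (m - 1) ω' n) {x y : ℝ}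
    (hx : x ∈ cylinder (actB m) (dom m) ω n) (hy : y ∈ cylinder (actB m) (dom m) ω' n) :
    x ≤ y := by
  induction n generalizing ω ω' x y with
  | zero => simp [wordIndex] at h
  | succ n ih =>
    obtain ⟨x, hx, rfl⟩ := hx
    obtain ⟨y, hy, rfl⟩ := hy
    have hs := shift_mem_digitSeq hω
    have hs' := shift_mem_digitSeq hω'
    have hxd := cylinder_subset (actB_mapsTo hm) hs n hx
    have hyd := cylinder_subset (actB_mapsTo hm) hs' n hy
    have hN := wordIndex_lt hm hs n
    have hN' := wordIndex_lt hm hs' n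
    obtain ⟨h1, h2⟩ := hω 0
    obtain ⟨h1', h2'⟩ := hω' 0
    rw [wordIndex, wordIndex] at h
    rcases lt_trichotomy (ω 0) (ω' 0) with h0 | h0 | h0
    · calc actB m (ω 0) x ≤ cut m (ω 0 + 1) :=
            ((image_actB_dom hm (hω 0)).subset (mem_image_of_mem _ hxd)).2
        _ ≤ cut m (ω' 0) := cut_mono hm (by omega) h0 (by omega)
        _ ≤ actB m (ω' 0) y :=
            ((image_actB_dom hm (hω' 0)).subset (mem_image_of_mem _ hyd)).1
    · rw [h0] at h ⊢
      exact actB_monotoneOn hm (hω' 0) hxd hyd (ih hs hs' (by omega) hx hy)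
    -- Impossible case: the tail index is below `q ^ n`, so it cannot offset a larger first digit.
    · have : (ω' 0 - 1 + 1) * (m - 1) ^ n ≤ (ω 0 - 1) * (m - 1) ^ n :=
        Nat.mul_le_mul_right _ (by omega)
      rw [add_mul, one_mul] at this
      omega

/-- The cylinder with the next index after that of `ω` lies between the two points, and its length
is `1 / (c d) ≥ 1 / (c² + d²)`. -/
theorem inv_le_sub_of_wordIndex_add_two_le (hm : 3 ≤ m) (hω : ω ∈ digitSeq m)
    (hω' : ω' ∈ digitSeq m) {n : ℕ}
    (h : wordIndex (m - 1) ω n + 2 ≤ wordIndex (m - 1) ω' n) :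
    (5 * (rho m ^ 2) ^ n)⁻¹ ≤ piB m ω' - piB m ω := by
  obtain ⟨υ, hυ, hυN⟩ := exists_wordIndex_eq hm (n := n) (N := wordIndex (m - 1) ω n + 1)
    (by have := wordIndex_lt hm hω' n; omega)
  obtain ⟨hc, hd, -⟩ := cylMatrix_row_lower hm hυ n
  have hlen := cylMatrix_right_sub_left hm hυ n
  have hle : cylMatrix m υ n 0 1 / cylMatrix m υ n 1 1 ≤
      cylMatrix m υ n 0 0 / cylMatrix m υ n 1 0 := by
    rw [← sub_nonneg, hlen]
    positivity
  have hcyl := cylinder_actB_eq hm hυ n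
  have h1 := le_of_wordIndex_lt hm hω hυ (by omega) (piB_mem_cylinder hm hω n)
    (hcyl ▸ left_mem_Icc.2 hle)
  have h2 := le_of_wordIndex_lt hm hυ hω' (by omega) (hcyl ▸ right_mem_Icc.2 hle)
    (piB_mem_cylinder hm hω' n)
  have h3 : (5 * (rho m ^ 2) ^ n)⁻¹ ≤ (cylMatrix m υ n 1 0 * cylMatrix m υ n 1 1)⁻¹ := by
    refine inv_anti₀ (by positivity) ?_
    have := cylMatrix_row_sq_le hm hυ n
    nlinarith [sq_nonneg (cylMatrix m υ n 1 0 - cylMatrix m υ n 1 1)]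
  linarith

end WordIndex

/-! ### The cylinders of the maps `C_j` -/

section CylinderC

variable {m : ℕ} {ω : ℕ → ℕ}

theorem two_le_natCast_sub_one (hm : 3 ≤ m) : (2 : ℝ) ≤ (m : ℝ) - 1 := by
  have : (3 : ℝ) ≤ m := by exact_mod_cast hm
  linarith

theorem actC_eq (j : ℕ) (x : ℝ) : actC m j x = (x + (j - 1)) / ((m : ℝ) - 1) := by
  simp [actC, mobius, C]
  ring

theorem image_actC_Icc (hm : 3 ≤ m) (j : ℕ) {a b : ℝ} (hab : a ≤ b) :
    actC m j '' Icc a b = Icc (actC m j a) (actC m j b) := by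
  have hq := two_le_natCast_sub_one hm
  rw [show actC m j = _ from funext (actC_eq j)]
  refine ContinuousOn.image_Icc_of_monotoneOn hab (by fun_prop) fun x _ y _ hxy => ?_
  gcongr

theorem actC_mapsTo (hm : 3 ≤ m) :
    ∀ j ∈ Icc 1 (m - 1), MapsTo (actC m j) (Icc 0 1) (Icc 0 1) := by
  intro j hj x hx
  have hq := two_le_natCast_sub_one hm
  obtain ⟨h1, h2⟩ := natCast_bounds_of_digit hm hj
  obtain ⟨hx0, hx1⟩ := hx
  rw [actC_eq, mem_Icc, div_le_one (by linarith)]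
  exact ⟨div_nonneg (by linarith) (by linarith), by linarith⟩

theorem cylinder_actC_eq (hm : 3 ≤ m) (hω : ω ∈ digitSeq m) (n : ℕ) :
    cylinder (actC m) (Icc 0 1) ω n = Icc (wordIndex (m - 1) ω n / ((m : ℝ) - 1) ^ n)
      ((wordIndex (m - 1) ω n + 1) / ((m : ℝ) - 1) ^ n) := by
  have hq := two_le_natCast_sub_one hm
  induction n generalizing ω with
  | zero => simp [cylinder, wordIndex]
  | succ n ih =>
    have hq0 : (m : ℝ) - 1 ≠ 0 := by linarith
    have hle : (wordIndex (m - 1) (fun k => ω (k + 1)) n : ℝ) / ((m : ℝ) - 1) ^ n ≤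
        (wordIndex (m - 1) (fun k => ω (k + 1)) n + 1) / ((m : ℝ) - 1) ^ n :=
      div_le_div_of_nonneg_right (by linarith) (pow_nonneg (by linarith) n)
    rw [cylinder, ih (shift_mem_digitSeq hω), image_actC_Icc hm _ hle, actC_eq, actC_eq, wordIndex]
    push_cast [Nat.cast_sub (hω 0).1, Nat.cast_sub (show 1 ≤ m by omega)]
    congr 1 <;> field_simp <;> ring

theorem iInter_cylinder_actC (hm : 3 ≤ m) (hω : ω ∈ digitSeq m) :
    ⋂ n, cylinder (actC m) (Icc 0 1) ω n = {piC m ω} := by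
  have hq := two_le_natCast_sub_one hm
  refine iInter_cylinder_eq_coding (exists_iInter_eq_singleton (cylinder_actC_eq hm hω)
    (cylinder_succ_subset (actC_mapsTo hm) hω) (fun n => ?_) ?_)
  · exact div_le_div_of_nonneg_right (by linarith) (pow_nonneg (by linarith) n)
  · have h := tendsto_pow_atTop_nhds_zero_of_lt_one (r := ((m : ℝ) - 1)⁻¹)
      (inv_nonneg.2 (by linarith)) (inv_lt_one_of_one_lt₀ (by linarith))
    refine h.congr fun n => ?_
    rw [← sub_div, add_sub_cancel_left, one_div, inv_pow]

theorem piC_mem (hm : 3 ≤ m) (hω : ω ∈ digitSeq m) (n : ℕ) :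
    piC m ω ∈ Icc (wordIndex (m - 1) ω n / ((m : ℝ) - 1) ^ n)
      ((wordIndex (m - 1) ω n + 1) / ((m : ℝ) - 1) ^ n) := by
  have h : piC m ω ∈ ⋂ n, cylinder (actC m) (Icc 0 1) ω n := by
    rw [iInter_cylinder_actC hm hω]
    rfl
  rw [← cylinder_actC_eq hm hω]
  exact mem_iInter.1 h n

end CylinderC

/-! ### Hölder continuity -/

section Holder

variable {m : ℕ} {ω ω' : ℕ → ℕ}

theorem alpha_pos (hm : 3 ≤ m) : 0 < alpha m :=
  div_pos (log_pos (by linarith [two_le_natCast_sub_one hm]))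
    (mul_pos two_pos (log_pos (one_lt_rho hm)))

theorem rho_sq_rpow_alpha (hm : 3 ≤ m) : (rho m ^ 2) ^ alpha m = (m : ℝ) - 1 := by
  have hρ := one_lt_rho hm
  have hlog := log_pos hρ
  rw [rpow_def_of_pos (by positivity), log_pow, alpha]
  push_cast
  rw [mul_div_cancel₀ _ (by positivity), exp_log (by linarith [two_le_natCast_sub_one hm])]

theorem piC_sub_le (hm : 3 ≤ m) (hω : ω ∈ digitSeq m) (hω' : ω' ∈ digitSeq m)
    (hlt : piC m ω < piC m ω') :
    piC m ω' - piC m ω ≤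
      2 * ((m : ℝ) - 1) * 5 ^ alpha m * |piB m ω' - piB m ω| ^ alpha m := by
  have hq := two_le_natCast_sub_one hm
  have hρ := one_lt_rho hm
  have hα := alpha_pos hm
  set q : ℝ := (m : ℝ) - 1
  set δ := piC m ω' - piC m ω with hδ
  have hδ0 : 0 < δ := sub_pos.2 hlt
  have hex : ∃ n : ℕ, 2 / q ^ n < δ := by
    obtain ⟨n, hn⟩ := pow_unbounded_of_one_lt (2 / δ) (show 1 < q by linarith)
    refine ⟨n, ?_⟩
    rw [div_lt_iff₀ hδ0] at hn
    rw [div_lt_iff₀ (by positivity)]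
    linarith
  classical
  -- Take the first level that resolves `δ`. It is not level 0, because `δ ≤ 1 < 2`.
  obtain ⟨n, hn, hmin⟩ : ∃ n : ℕ, 2 / q ^ (n + 1) < δ ∧ δ ≤ 2 / q ^ n := by
    have h0 : Nat.find hex ≠ 0 := by
      intro h
      have h1 := Nat.find_spec hex
      have h2 := piC_mem hm hω 0
      have h3 := piC_mem hm hω' 0
      rw [h] at h1
      simp [wordIndex] at h1 h2 h3
      linarith
    obtain ⟨n, hn⟩ := Nat.exists_eq_succ_of_ne_zero h0
    refine ⟨n, ?_, not_lt.1 (Nat.find_min hex (by omega))⟩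
    rw [← Nat.succ_eq_add_one, ← hn]
    exact Nat.find_spec hex
  have hidx : wordIndex (m - 1) ω (n + 1) + 2 ≤ wordIndex (m - 1) ω' (n + 1) := by
    have h1 := (piC_mem hm hω (n + 1)).1
    have h2 := (piC_mem hm hω' (n + 1)).2
    have h3 : 2 / q ^ (n + 1) < (wordIndex (m - 1) ω' (n + 1) + 1) / q ^ (n + 1) -
        wordIndex (m - 1) ω (n + 1) / q ^ (n + 1) := by linarith
    rw [← sub_div, div_lt_div_iff_of_pos_right (by positivity)] at h3
    have h4 : (wordIndex (m - 1) ω (n + 1) : ℝ) + 1 < wordIndex (m - 1) ω' (n + 1) := by linarith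
    have h5 : wordIndex (m - 1) ω (n + 1) + 1 < wordIndex (m - 1) ω' (n + 1) := by
      exact_mod_cast h4
    omega
  have hgap := inv_le_sub_of_wordIndex_add_two_le hm hω hω' hidx
  have hpow : (5 ^ alpha m * q ^ (n + 1))⁻¹ ≤ |piB m ω' - piB m ω| ^ alpha m := by
    have h := rpow_le_rpow (by positivity) (hgap.trans (le_abs_self _)) hα.le
    rwa [inv_rpow (by positivity), mul_rpow (by positivity) (by positivity), ← rpow_natCast,
      ← rpow_mul (by positivity), mul_comm ((n + 1 : ℕ) : ℝ), rpow_mul (by positivity),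
      rho_sq_rpow_alpha hm, rpow_natCast] at h
  calc δ ≤ 2 / q ^ n := hmin
    _ = 2 * q * 5 ^ alpha m * (5 ^ alpha m * q ^ (n + 1))⁻¹ := by
      have : (5 : ℝ) ^ alpha m ≠ 0 := by positivity
      field_simp
      ring
    _ ≤ _ := by gcongr

theorem abs_piC_sub_le (hm : 3 ≤ m) (hω : ω ∈ digitSeq m) (hω' : ω' ∈ digitSeq m) :
    |piC m ω - piC m ω'| ≤
      2 * ((m : ℝ) - 1) * 5 ^ alpha m * |piB m ω - piB m ω'| ^ alpha m := by
  have hq := two_le_natCast_sub_one hm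
  rcases lt_trichotomy (piC m ω) (piC m ω') with h | h | h
  · rw [abs_sub_comm, abs_sub_comm (piB m ω), abs_of_pos (sub_pos.2 h)]
    exact piC_sub_le hm hω hω' h
  · rw [h, sub_self, abs_zero]
    positivity
  · rw [abs_of_pos (sub_pos.2 h)]
    exact piC_sub_le hm hω' hω h

/-- Two codes of one point are at `piB`-distance zero, so the Hölder estimate forces equal
`piC`-values; `0 ^ α = 0` needs `α ≠ 0`. -/
theorem minkowski_piB (hm : 3 ≤ m) (hω : ω ∈ digitSeq m) :
    minkowski m (piB m ω) = piC m ω := by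
  have hex : ∃ υ ∈ digitSeq m, piB m υ = piB m ω := ⟨ω, hω, rfl⟩
  have h := abs_piC_sub_le hm (Function.invFunOn_mem hex) hω
  rw [Function.invFunOn_eq hex, sub_self, abs_zero, zero_rpow (alpha_pos hm).ne', mul_zero,
    abs_nonpos_iff, sub_eq_zero] at h
  exact h

theorem holderOnWith_iff_abs {K α : NNReal} {f : ℝ → ℝ} {s : Set ℝ} :
    HolderOnWith K α f s ↔ ∀ x ∈ s, ∀ y ∈ s, |f x - f y| ≤ K * |x - y| ^ (α : ℝ) := by
  refine forall₄_congr fun x _ y _ => ?_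
  rw [edist_dist, edist_dist, ENNReal.ofReal_rpow_of_nonneg dist_nonneg α.coe_nonneg,
    ← ENNReal.ofReal_coe_nnreal, ← ENNReal.ofReal_mul K.coe_nonneg, ENNReal.ofReal_le_ofReal_iff
    (by positivity), Real.dist_eq, Real.dist_eq]

theorem exists_holderOnWith_minkowski (hm : 3 ≤ m) {α : NNReal} (hα : (α : ℝ) = alpha m) :
    ∃ K : NNReal, HolderOnWith K α (minkowski m) (dom m) := by
  have hq := two_le_natCast_sub_one hm
  refine ⟨⟨2 * ((m : ℝ) - 1) * 5 ^ alpha m, by positivity⟩, holderOnWith_iff_abs.2 ?_⟩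
  rw [← image_piB hm, hα]
  rintro _ ⟨ω, hω, rfl⟩ _ ⟨ω', hω', rfl⟩
  rw [minkowski_piB hm hω, minkowski_piB hm hω']
  exact abs_piC_sub_le hm hω hω'

end Holder

/-! ### Optimality of the exponent -/

section Optimality

variable {m : ℕ}

theorem growth_of_recurrence {τ : ℝ} (hτ : 1 < τ) {x : ℕ → ℝ} (h0 : ∀ n, 1 ≤ x n)
    (h01 : x 0 ≤ x 1) (hrec : ∀ n, x (n + 2) = (τ + τ⁻¹) * x (n + 1) - x n) (n : ℕ) :
    (1 - τ⁻¹) * τ ^ n ≤ x (n + 1) := by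
  have hτ0 : 0 < τ⁻¹ := inv_pos.2 (by linarith)
  have hτ1 : τ⁻¹ < 1 := inv_lt_one_of_one_lt₀ hτ
  have hmul : τ * τ⁻¹ = 1 := mul_inv_cancel₀ (by linarith)
  -- The recurrence has characteristic roots `τ` and `τ⁻¹`, so `x (n + 1) - τ⁻¹ * x n` is multiplied
  -- by exactly `τ` at each step.
  have h : (1 - τ⁻¹) * τ ^ n ≤ x (n + 1) - τ⁻¹ * x n := by
    induction n with
    | zero =>
      rw [pow_zero, mul_one, zero_add]
      nlinarith [h0 0]
    | succ n ih =>
      rw [hrec, pow_succ]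
      calc (1 - τ⁻¹) * (τ ^ n * τ) = (1 - τ⁻¹) * τ ^ n * τ := by ring
        _ ≤ (x (n + 1) - τ⁻¹ * x n) * τ := by gcongr
        _ = _ := by linear_combination (-x n) * hmul
  nlinarith [h0 n]

/-- The periodic sequence `m - k, k, m - k, k, …` with `k = ⌊m/2⌋`. -/
def alternating (m : ℕ) (i : ℕ) : ℕ := if Even i then m - m / 2 else m / 2

theorem alternating_mem (hm : 3 ≤ m) : alternating m ∈ digitSeq m := by
  intro i
  unfold alternating
  split_ifs
  · exact sub_half_mem hm
  · exact half_mem hm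

/-- The product `A_{m-k} A_k` with `k = ⌊m/2⌋`. -/
def period (m : ℕ) : Matrix (Fin 2) (Fin 2) ℝ := A m (m - m / 2) * A m (m / 2)

theorem det_period (hm : 3 ≤ m) : (period m).det = 1 := by
  rw [period, Matrix.det_mul, det_A hm, det_A hm, one_mul]

theorem trace_period (hm : 3 ≤ m) : period m 0 0 + period m 1 1 = rho m ^ 2 + (rho m ^ 2)⁻¹ := by
  rw [(rho_spec hm).2, ← sum_sq_A hm, period, A_sub_eq_transpose hm (Nat.div_le_self _ _)]
  simp only [Matrix.mul_apply, Fin.sum_univ_two, Matrix.transpose_apply]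
  ring

theorem cylMatrix_alternating_succ (n : ℕ) :
    cylMatrix m (alternating m) (2 * (n + 1)) =
      cylMatrix m (alternating m) (2 * n) * period m := by
  rw [mul_add, mul_one, cylMatrix_succ, cylMatrix_succ, period, mul_assoc]
  simp [alternating]

/-- Cayley–Hamilton for `period m`, of determinant 1 and trace `‖A_k‖_F² = ρ² + ρ⁻²`. -/
theorem cylMatrix_alternating_recurrence (hm : 3 ≤ m) (n : ℕ) (j : Fin 2) :
    cylMatrix m (alternating m) (2 * (n + 2)) 1 j =
      (rho m ^ 2 + (rho m ^ 2)⁻¹) * cylMatrix m (alternating m) (2 * (n + 1)) 1 j -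
        cylMatrix m (alternating m) (2 * n) 1 j := by
  have hdet := det_period hm
  rw [Matrix.det_fin_two] at hdet
  rw [cylMatrix_alternating_succ (n + 1), cylMatrix_alternating_succ n, ← trace_period hm]
  fin_cases j <;> simp only [Matrix.mul_apply, Fin.sum_univ_two, Fin.zero_eta, Fin.mk_one]
  · linear_combination (-cylMatrix m (alternating m) (2 * n) 1 0) * hdet
  · linear_combination (-cylMatrix m (alternating m) (2 * n) 1 1) * hdet

theorem cylMatrix_row_le_succ (hm : 3 ≤ m) {ω : ℕ → ℕ} (hω : ω ∈ digitSeq m) (n : ℕ)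
    (j : Fin 2) : cylMatrix m ω n 1 j ≤ cylMatrix m ω (n + 1) 1 j := by
  obtain ⟨hc, hd, -⟩ := cylMatrix_row_lower hm hω n
  have h1 := one_le_sinRatio_digit hm (hω n)
  have h2 := sinRatio_digit_sub_one_nonneg hm (hω n)
  have h3 := sinRatio_digit_add_one_nonneg hm (hω n)
  fin_cases j
  · simp only [Fin.zero_eta, (cylMatrix_row_succ hm n).1]
    nlinarith
  · simp only [Fin.mk_one, (cylMatrix_row_succ hm n).2]
    nlinarith

theorem le_cylMatrix_alternating (hm : 3 ≤ m) (n : ℕ) (j : Fin 2) :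
    (1 - (rho m ^ 2)⁻¹) * (rho m ^ 2) ^ n ≤ cylMatrix m (alternating m) (2 * (n + 1)) 1 j := by
  have hω := alternating_mem hm
  refine growth_of_recurrence (x := fun n => cylMatrix m (alternating m) (2 * n) 1 j)
    (one_lt_pow₀ (one_lt_rho hm) two_ne_zero) (fun n => ?_) ?_
    (fun n => cylMatrix_alternating_recurrence hm n j) n
  · obtain ⟨hc, hd, -⟩ := cylMatrix_row_lower hm hω (2 * n)
    fin_cases j
    exacts [hc, hd]
  · exact (cylMatrix_row_le_succ hm hω 0 j).trans (cylMatrix_row_le_succ hm hω 1 j)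

theorem cylMatrix_congr {ω ω' : ℕ → ℕ} {n : ℕ} (h : ∀ i < n, ω i = ω' i) :
    cylMatrix m ω n = cylMatrix m ω' n := by
  rw [cylMatrix, cylMatrix, List.map_congr_left fun i hi => by rw [h i (List.mem_range.1 hi)]]

theorem exists_close_points (hm : 3 ≤ m) (n : ℕ) :
    ∃ ω ∈ digitSeq m, ∃ ω' ∈ digitSeq m,
      |piB m ω - piB m ω'| ≤ (((1 - (rho m ^ 2)⁻¹) * (rho m ^ 2) ^ n) ^ 2)⁻¹ ∧
      (((m : ℝ) - 1) ^ (2 * n + 4))⁻¹ ≤ |piC m ω - piC m ω'| := by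
  have hq := two_le_natCast_sub_one hm
  have hτ : 1 < rho m ^ 2 := one_lt_pow₀ (one_lt_rho hm) two_ne_zero
  have hτ1 : 0 < 1 - (rho m ^ 2)⁻¹ := sub_pos.2 (inv_lt_one_of_one_lt₀ hτ)
  have halt := alternating_mem hm
  -- Follow the alternating sequence for `2 (n + 1)` digits, then use the constant tail `v`; the
  -- extreme tails are `1` and `m - 1`.
  set ω : ℕ → ℕ → ℕ := fun v i => if i < 2 * (n + 1) then alternating m i else v with hωdef
  have hω : ∀ v ∈ Icc 1 (m - 1), ω v ∈ digitSeq m := by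
    intro v hv i
    simp only [hωdef]
    split_ifs
    exacts [halt i, hv]
  have hagree : ∀ v, ∀ i < 2 * (n + 1), ω v i = alternating m i := fun v i hi => if_pos hi
  have htail : ∀ v i, 2 * (n + 1) ≤ i → ω v i = v := fun v i hi => if_neg (by omega)
  have h1 : 1 ∈ Icc 1 (m - 1) := ⟨le_rfl, by omega⟩
  have h2 : m - 1 ∈ Icc 1 (m - 1) := ⟨by omega, le_rfl⟩
  refine ⟨ω 1, hω _ h1, ω (m - 1), hω _ h2, ?_, ?_⟩
  · have hmem : ∀ v ∈ Icc 1 (m - 1), piB m (ω v) ∈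
        Icc (cylMatrix m (alternating m) (2 * (n + 1)) 0 1 /
            cylMatrix m (alternating m) (2 * (n + 1)) 1 1)
          (cylMatrix m (alternating m) (2 * (n + 1)) 0 0 /
            cylMatrix m (alternating m) (2 * (n + 1)) 1 0) := by
      intro v hv
      have h := piB_mem_cylinder hm (hω v hv) (2 * (n + 1))
      rwa [cylinder_actB_eq hm (hω v hv), cylMatrix_congr (hagree v)] at h
    obtain ⟨ha, hb⟩ := hmem _ h1
    obtain ⟨ha', hb'⟩ := hmem _ h2
    have hlen := cylMatrix_right_sub_left hm halt (2 * (n + 1))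
    have hinv : (cylMatrix m (alternating m) (2 * (n + 1)) 1 0 *
        cylMatrix m (alternating m) (2 * (n + 1)) 1 1)⁻¹ ≤
          (((1 - (rho m ^ 2)⁻¹) * (rho m ^ 2) ^ n) ^ 2)⁻¹ := by
      refine inv_anti₀ (by positivity) ?_
      rw [sq]
      exact mul_le_mul (le_cylMatrix_alternating hm n 0) (le_cylMatrix_alternating hm n 1)
        (by positivity) (le_trans (by positivity) (le_cylMatrix_alternating hm n 0))
    refine le_trans ?_ hinv
    rw [abs_le]
    constructor <;> linarith
  -- Two tail digits separate the indices by `q² - 1`, leaving a gap of `q² - 2 ≥ 1` intervals. A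
  -- single digit would leave `q - 2`, which is 0 for `m = 3`.
  · have hidx : ∀ v, wordIndex (m - 1) (ω v) (2 * n + 4) =
        (wordIndex (m - 1) (alternating m) (2 * (n + 1)) * (m - 1) + (v - 1)) * (m - 1) +
          (v - 1) := by
      intro v
      rw [show 2 * n + 4 = 2 * (n + 1) + 1 + 1 by ring, wordIndex_succ, wordIndex_succ,
        wordIndex_congr _ (hagree v), htail v _ le_rfl, htail v _ (by omega)]
    have hlow := (piC_mem hm (hω _ h1) (2 * n + 4)).2
    have hhigh := (piC_mem hm (hω _ h2) (2 * n + 4)).1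
    rw [hidx] at hlow hhigh
    push_cast [Nat.cast_sub (show 1 ≤ m by omega), Nat.cast_sub (show 1 ≤ m - 1 by omega)]
      at hlow hhigh
    set q : ℝ := (m : ℝ) - 1
    set N : ℝ := (wordIndex (m - 1) (alternating m) (2 * (n + 1)) : ℝ)
    rw [abs_sub_comm]
    refine le_trans ?_ (le_abs_self _)
    refine le_trans ?_ (sub_le_sub hhigh hlow)
    rw [← sub_div, ← one_div]
    gcongr
    simp
    nlinarith

theorem not_holderOnWith_minkowski (hm : 3 ≤ m) {β : NNReal} (hβ : alpha m < β) (K : NNReal) :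
    ¬ HolderOnWith K β (minkowski m) (dom m) := by
  intro hK
  rw [holderOnWith_iff_abs] at hK
  have hq := two_le_natCast_sub_one hm
  have hα := alpha_pos hm
  have hrpow := rho_sq_rpow_alpha hm
  have hτ : 1 < rho m ^ 2 := one_lt_pow₀ (one_lt_rho hm) two_ne_zero
  have hκ : 0 < 1 - (rho m ^ 2)⁻¹ := sub_pos.2 (inv_lt_one_of_one_lt₀ hτ)
  set τ := rho m ^ 2
  set κ := 1 - τ⁻¹
  set q : ℝ := (m : ℝ) - 1
  -- Since `τ ^ α = q`, an exponent `β > α` makes this ratio exceed 1, whereas a Hölder bound would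
  -- keep all its powers below a fixed constant.
  have hratio : 1 < (τ ^ (β : ℝ) / q) ^ 2 := by
    refine one_lt_pow₀ ?_ two_ne_zero
    rw [one_lt_div (by linarith), ← hrpow]
    exact rpow_lt_rpow_of_exponent_lt hτ hβ
  obtain ⟨n, hn⟩ := pow_unbounded_of_one_lt (K * (κ ^ (2 * (β : ℝ)))⁻¹ * q ^ 4) hratio
  refine absurd hn (not_lt.2 ?_)
  obtain ⟨ω, hω, ω', hω', hB, hC⟩ := exists_close_points hm n
  have h := hK _ (image_piB hm ▸ mem_image_of_mem _ hω) _ (image_piB hm ▸ mem_image_of_mem _ hω')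
  rw [minkowski_piB hm hω, minkowski_piB hm hω'] at h
  have hpow : |piB m ω - piB m ω'| ^ (β : ℝ) ≤
      (κ ^ (2 * (β : ℝ)))⁻¹ * ((τ ^ (β : ℝ)) ^ (2 * n))⁻¹ := by
    calc |piB m ω - piB m ω'| ^ (β : ℝ) ≤ (((κ * τ ^ n) ^ 2)⁻¹) ^ (β : ℝ) :=
          rpow_le_rpow (abs_nonneg _) hB β.coe_nonneg
      _ = _ := by
        rw [inv_rpow (by positivity), mul_pow, mul_rpow (by positivity) (by positivity), mul_inv,
          rpow_mul hκ.le, rpow_two, ← pow_mul, mul_comm n 2, ← rpow_natCast τ,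
          ← rpow_natCast (τ ^ (β : ℝ)), ← rpow_mul (by positivity), ← rpow_mul (by positivity),
          mul_comm ((2 * n : ℕ) : ℝ)]
  have hfin : (q ^ (2 * n + 4))⁻¹ ≤
      K * ((κ ^ (2 * (β : ℝ)))⁻¹ * ((τ ^ (β : ℝ)) ^ (2 * n))⁻¹) :=
    hC.trans (h.trans (mul_le_mul_of_nonneg_left hpow K.coe_nonneg))
  have hT : 0 < (τ ^ (β : ℝ)) ^ (2 * n) := by positivity
  calc ((τ ^ (β : ℝ) / q) ^ 2) ^ n
      = (τ ^ (β : ℝ)) ^ (2 * n) * q ^ 4 * (q ^ (2 * n + 4))⁻¹ := by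
        rw [← pow_mul, div_pow]
        field_simp
        ring
    _ ≤ (τ ^ (β : ℝ)) ^ (2 * n) * q ^ 4 *
        (K * ((κ ^ (2 * (β : ℝ)))⁻¹ * ((τ ^ (β : ℝ)) ^ (2 * n))⁻¹)) := by gcongr
    _ = K * (κ ^ (2 * (β : ℝ)))⁻¹ * q ^ 4 := by
        field_simp

end Optimality

end

end HeckeMinkowski

theorem theorem4 (m : ℕ) (hm : 3 ≤ m) :
    -- the Minkowski function is well defined on `[0, λ_m⁻¹]`
    ((∀ ω ∈ HeckeMinkowski.digitSeq m,
        ⋂ n, HeckeMinkowski.cylinder (HeckeMinkowski.actB m) (HeckeMinkowski.dom m) ω n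
          = {HeckeMinkowski.piB m ω} ∧
        ⋂ n, HeckeMinkowski.cylinder (HeckeMinkowski.actC m) (Set.Icc 0 1) ω n
          = {HeckeMinkowski.piC m ω} ∧
        HeckeMinkowski.minkowski m (HeckeMinkowski.piB m ω) = HeckeMinkowski.piC m ω) ∧
      HeckeMinkowski.piB m '' HeckeMinkowski.digitSeq m = HeckeMinkowski.dom m) ∧
    -- the joint spectral radius
    HeckeMinkowski.jointSpectralRadius (HeckeMinkowski.A m '' Set.Icc 1 (m - 1))
      = HeckeMinkowski.rho m ∧
    -- the optimal Hölder exponent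
    ∃ α : NNReal, (α : ℝ) = HeckeMinkowski.alpha m ∧
      (∃ K : NNReal,
        HolderOnWith K α (HeckeMinkowski.minkowski m) (HeckeMinkowski.dom m)) ∧
      ∀ β : NNReal, α < β →
        ¬ ∃ K : NNReal,
          HolderOnWith K β (HeckeMinkowski.minkowski m) (HeckeMinkowski.dom m) := by
  refine ⟨⟨fun ω hω => ⟨HeckeMinkowski.iInter_cylinder_actB hm hω,
    HeckeMinkowski.iInter_cylinder_actC hm hω, HeckeMinkowski.minkowski_piB hm hω⟩,
    HeckeMinkowski.image_piB hm⟩, HeckeMinkowski.jointSpectralRadius_A hm,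
    ⟨HeckeMinkowski.alpha m, (HeckeMinkowski.alpha_pos hm).le⟩, rfl,
    HeckeMinkowski.exists_holderOnWith_minkowski hm rfl, ?_⟩
  rintro β hβ ⟨K, hK⟩
  exact HeckeMinkowski.not_holderOnWith_minkowski hm (by exact_mod_cast hβ) K hK
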